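/- For a compact convex set $S$ in a finite-dimensional real affine space that it affinely spans, let $E_{\rm out}$ be the least-volume ellipsoid containing $S$, and let $S_{\rm centered}$ be $S$ translated so that the center of $E_{\rm out}$ is at the origin. The coefficient of symmetry of $S$ is the largest $\alpha\in[0,1]$ such that $-\alpha x\in S_{\rm centered}$ for every $x\in S_{\rm centered}$. Proposition. Let $n\ge 2$ and $d=n^2$. Let $\Psi=\frac1{\sqrt n}\sum_{i=1}^n e_i\otimes e_i\in\mathbb C^n\otimes\mathbb C^n$ and $\pi=\Psi\Psi^\dagger$. Let $F$ be the convex hull of all maximally entangled states of an $n\times n$ bipartite system, that is, the convex hull of $$\{(u\otimes v)\,\pi\,(u^\dagger\otimes v^\dagger) : u,v\in U(n)\},$$ regarded as a subset of its affine span, a real affine subspace of the $d\times d$ complex matrices. Then $F$ has a least-volume enclosing ellipsoid in its affine span, and the coefficient of symmetry of $F$ is $\frac1{d-1}$. -/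

import Mathlib

open scoped Kronecker

section CoefficientOfSymmetry

variable {V : Type*} [AddCommGroup V] [Module ℝ V]

/-- `p` is an affine coordinate system on the affine subspace `P`: an injective affine map
from some `ℝᵏ` onto `P` (so that `k` is the dimension of `P`). -/
def IsCoordinateSystem (P : AffineSubspace ℝ V) {k : ℕ}
    (p : EuclideanSpace ℝ (Fin k) →ᵃ[ℝ] V) : Prop :=
  Function.Injective p ∧ Set.range p = (P : Set V)

/-- `E` is a (full-dimensional, solid) ellipsoid of the affine subspace `P` with center `c`:
the image of the closed Euclidean unit ball under an affine isomorphism onto `P` that sends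
the origin to `c`. -/
def IsEllipsoid (P : AffineSubspace ℝ V) (c : V) (E : Set V) : Prop :=
  ∃ (k : ℕ) (f : EuclideanSpace ℝ (Fin k) →ᵃ[ℝ] V),
    IsCoordinateSystem P f ∧ f 0 = c ∧ E = f '' Metric.closedBall 0 1

/-- `E`, with center `c`, is a least-volume ellipsoid containing `S`. Ellipsoids are taken in
the affine span of `S`, the affine space in which the convex set `S` has nonempty interior.
Volume is Lebesgue measure in affine coordinates on that span; changing the coordinates
multiplies all volumes by one positive constant, so the comparison does not depend on them. -/
def IsLeastVolumeEllipsoid (S : Set V) (c : V) (E : Set V) : Prop :=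
  IsEllipsoid (affineSpan ℝ S) c E ∧ S ⊆ E ∧
    ∀ (c' : V) (E' : Set V), IsEllipsoid (affineSpan ℝ S) c' E' → S ⊆ E' →
      ∀ (k : ℕ) (p : EuclideanSpace ℝ (Fin k) →ᵃ[ℝ] V),
        IsCoordinateSystem (affineSpan ℝ S) p →
          MeasureTheory.volume (p ⁻¹' E) ≤ MeasureTheory.volume (p ⁻¹' E')

/-- `S` translated so that `c` is moved to the origin. -/
def centeredAt (S : Set V) (c : V) : Set V := (fun x => x - c) '' S

/-- `α` is the coefficient of symmetry of `S`: `S` has a least-volume enclosing ellipsoid, and,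
when `S` is translated so that the center of such an ellipsoid is the origin, `α` is the largest
`a ∈ [0, 1]` for which `-a x` lies in the translated set for every `x` of the translated set. -/
def IsCoefficientOfSymmetry (S : Set V) (α : ℝ) : Prop :=
  (∃ (c : V) (E : Set V), IsLeastVolumeEllipsoid S c E) ∧
    ∀ (c : V) (E : Set V), IsLeastVolumeEllipsoid S c E →
      IsGreatest {a : ℝ | 0 ≤ a ∧ a ≤ 1 ∧ ∀ x ∈ centeredAt S c, -(a • x) ∈ centeredAt S c} α

end CoefficientOfSymmetry

noncomputable section MaximallyEntangled

/-- The unit vector `Ψ = (1/√n) ∑ₖ eₖ ⊗ eₖ` of `ℂⁿ ⊗ ℂⁿ`, whose coordinates are indexed by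
pairs. -/
def maxEntangledVector (n : ℕ) : Fin n × Fin n → ℂ :=
  fun ij => ((1 / Real.sqrt n : ℝ) : ℂ) *
    ∑ k : Fin n, (Pi.single k 1 : Fin n → ℂ) ij.1 * (Pi.single k 1 : Fin n → ℂ) ij.2

/-- The state `π = Ψ Ψ†`. -/
def maxEntangledState (n : ℕ) : Matrix (Fin n × Fin n) (Fin n × Fin n) ℂ :=
  Matrix.vecMulVec (maxEntangledVector n) (star (maxEntangledVector n))

/-- The maximally entangled states: the orbit of `π` under conjugation by local unitaries
`u ⊗ v`, with `(u, v) ∈ U(n) × U(n)`. -/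
def maxEntangledStates (n : ℕ) : Set (Matrix (Fin n × Fin n) (Fin n × Fin n) ℂ) :=
  {X | ∃ u ∈ Matrix.unitaryGroup (Fin n) ℂ, ∃ v ∈ Matrix.unitaryGroup (Fin n) ℂ,
    X = (u ⊗ₖ v) * maxEntangledState n * (u.conjTranspose ⊗ₖ v.conjTranspose)}

/-- The convex hull `F` of the maximally entangled states. -/
def maxEntangledHull (n : ℕ) : Set (Matrix (Fin n × Fin n) (Fin n × Fin n) ℂ) :=
  convexHull ℝ (maxEntangledStates n)

end MaximallyEntangled

/-! ### John's criterion for least-volume ellipsoids -/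

section LeastVolumeEllipsoid

variable {V : Type*} [AddCommGroup V] [Module ℝ V]

/-! Write P_w for the projection onto vec(w)/√n. Since (u ⊗ v) vec(w) = vec(u w vᵀ), the maximally
entangled states are exactly the P_w with w unitary, and local unitaries act on w by left and right
multiplication.

Center: all P_w lie on one Hilbert-Schmidt sphere around c = 1/n². By John's criterion
(`isLeastVolumeEllipsoid_of_tightFrame`) the ball bounded by that sphere in the affine span is a
least-volume ellipsoid, and c is the only possible center, once the points P_w - c for Haar-random w
have mean zero and isotropic covariance. The second moment of w ↦ tr(Z P_w) is a bilinear form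
invariant under local unitaries, so `exists_secondMoment_eq` makes it a combination of tr(ZZ'), the
two analogues for partial traces, and tr Z tr Z'. Differences of maximally entangled states have
zero partial traces, so on the directions of the span only the multiple of tr(ZZ') survives: this is
isotropy.

Symmetry: each P_w belongs to a Bell basis of n² = d maximally entangled states summing to 1
(`exists_sum_vecProjection_eq_one`). The reflection of P_w through c with ratio 1/(d-1) is (1 -
P_w)/(d-1), the average of the other d-1 states of that basis, hence lies in the hull. No larger
ratio works, because tr(P_w X) ≥ 0 on the hull and this value is already 0 at (1 - P_w)/(d-1). -/

/-- Two affine coordinate systems on the same affine subspace differ by an affine equivalence. -/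
theorem IsCoordinateSystem.exists_affineEquiv {P : AffineSubspace ℝ V} {k l : ℕ}
    {p : EuclideanSpace ℝ (Fin k) →ᵃ[ℝ] V} {q : EuclideanSpace ℝ (Fin l) →ᵃ[ℝ] V}
    (hp : IsCoordinateSystem P p) (hq : IsCoordinateSystem P q) :
    ∃ e : EuclideanSpace ℝ (Fin l) ≃ᵃ[ℝ] EuclideanSpace ℝ (Fin k), ∀ x, p (e x) = q x := by
  obtain ⟨L, hL⟩ := p.linear.exists_leftInverse_of_injective
    (LinearMap.ker_eq_bot.2 (p.linear_injective_iff.2 hp.1))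
  let e : EuclideanSpace ℝ (Fin l) →ᵃ[ℝ] EuclideanSpace ℝ (Fin k) :=
    L.toAffineMap.comp (q - AffineMap.const ℝ _ (p 0))
  have key : ∀ x y, p y = q x → e x = y := by
    intro x y h
    have h1 : p y - p 0 = p.linear y := by
      simpa using (p.linearMap_vsub y 0).symm
    have h2 : L (p.linear y) = y := LinearMap.congr_fun hL y
    simp only [e, AffineMap.comp_apply, AffineMap.coe_sub, Pi.sub_apply, AffineMap.const_apply,
      LinearMap.coe_toAffineMap, ← h, h1, h2]
  have he : ∀ x, p (e x) = q x := by
    intro x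
    obtain ⟨y, hy⟩ : q x ∈ Set.range p := by
      rw [hp.2, ← hq.2]; exact ⟨x, rfl⟩
    rw [key x y hy, hy]
  have hbij : Function.Bijective e := by
    refine ⟨fun x x' h => hq.1 ?_, fun y => ?_⟩
    · rw [← he, ← he, h]
    · obtain ⟨x, hx⟩ : p y ∈ Set.range q := by
        rw [hq.2, ← hp.2]; exact ⟨y, rfl⟩
      exact ⟨x, key x y hx.symm⟩
  exact ⟨AffineEquiv.ofBijective hbij, fun x => he x⟩

open scoped Pointwise in
theorem volume_image_affineMap {k : ℕ}
    (e : EuclideanSpace ℝ (Fin k) →ᵃ[ℝ] EuclideanSpace ℝ (Fin k))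
    (s : Set (EuclideanSpace ℝ (Fin k))) :
    MeasureTheory.volume (e '' s) =
      ENNReal.ofReal |LinearMap.det e.linear| * MeasureTheory.volume s := by
  have h : e '' s = e 0 +ᵥ (e.linear '' s) := by
    rw [← Set.image_vadd, Set.image_image]
    refine Set.image_congr fun x _ => ?_
    have := e.map_vadd 0 x
    simp only [vadd_eq_add, add_zero] at this ⊢
    rw [this, add_comm]
  rw [h, MeasureTheory.measure_vadd, MeasureTheory.Measure.addHaar_image_linearMap]

/-- An exponential form of AM-GM: det² and the sum of squared entries are the product and the sum of
the eigenvalues t ≥ 0 of M Mᴴ, and t ≤ exp(t - 1) for each of them. -/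
theorem Matrix.det_sq_le_exp {ι : Type*} [Fintype ι] [DecidableEq ι] (M : Matrix ι ι ℝ) :
    M.det ^ 2 ≤ Real.exp (∑ i, ∑ j, M i j ^ 2 - Fintype.card ι) := by
  have hpos := Matrix.posSemidef_self_mul_conjTranspose M
  have hdet : M.det ^ 2 = ∏ i, hpos.1.eigenvalues i := by
    have := hpos.1.det_eq_prod_eigenvalues
    simp only [Matrix.det_mul, Matrix.det_conjTranspose, star_trivial] at this
    rw [sq]; simpa using this
  have htr : ∑ i, ∑ j, M i j ^ 2 = ∑ i, hpos.1.eigenvalues i := by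
    have := hpos.1.trace_eq_sum_eigenvalues
    simp only [Matrix.trace, Matrix.diag, Matrix.mul_apply, Matrix.conjTranspose_apply,
      star_trivial] at this
    simpa [sq] using this
  rw [hdet, htr]
  have : ∑ i, hpos.1.eigenvalues i - Fintype.card ι = ∑ i, (hpos.1.eigenvalues i - 1) := by
    simp
  rw [this, Real.exp_sum]
  refine Finset.prod_le_prod (fun i _ => hpos.eigenvalues_nonneg i) fun i _ => ?_
  linarith [Real.add_one_le_exp (hpos.1.eigenvalues i - 1)]

open MeasureTheory in
/-- An affine self-map of `ℝᵏ` that sends a centred tight frame of unit trace into the unit ball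
is volume-decreasing, strictly unless it fixes the origin. -/
theorem det_sq_le_exp_of_tightFrame {k : ℕ} {Ω : Type*} [MeasurableSpace Ω] (μ : Measure Ω)
    [IsProbabilityMeasure μ] (y : Ω → EuclideanSpace ℝ (Fin k))
    (hint : ∀ (z : EuclideanSpace ℝ (Fin k)) (c : ℝ),
      Integrable (fun ω => (inner ℝ z (y ω) + c) ^ 2) μ)
    (hval : ∀ (z : EuclideanSpace ℝ (Fin k)) (c : ℝ),
      ∫ ω, (inner ℝ z (y ω) + c) ^ 2 ∂μ = ‖z‖ ^ 2 / k + c ^ 2)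
    (g : EuclideanSpace ℝ (Fin k) →ᵃ[ℝ] EuclideanSpace ℝ (Fin k))
    (hg : ∀ ω, ‖g (y ω)‖ ≤ 1) :
    (LinearMap.det g.linear) ^ 2 ≤ Real.exp (-(k * ‖g 0‖ ^ 2)) := by
  let bs := (EuclideanSpace.basisFun (Fin k) ℝ).toBasis
  let M := LinearMap.toMatrix bs bs g.linear
  let r : Fin k → EuclideanSpace ℝ (Fin k) := fun j => WithLp.toLp 2 (M j)
  have hr : ∀ j x, inner ℝ (r j) x + g 0 j = g x j := by
    intro j x
    have h1 : g x = g.linear x + g 0 := by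
      have := g.map_vadd 0 x
      simpa using this
    have h2 : g.linear x j = M.mulVec x j := by
      have hrepr : ∀ z, (bs.repr z : Fin k → ℝ) = z := fun z => by
        ext i
        simp [bs]
      have := congrFun (LinearMap.toMatrix_mulVec_repr bs bs g.linear x) j
      rw [hrepr, hrepr] at this
      exact this.symm
    rw [h1, PiLp.add_apply, h2]
    simp [r, Matrix.mulVec, dotProduct, PiLp.inner_apply, mul_comm]
  -- Average ‖g(y)‖² ≤ 1 over the frame, one coordinate of g at a time; the tight frame identity
  -- turns each average into the squared norm of a row over k plus the squared constant term.
  have hsum : ∑ j, (‖r j‖ ^ 2 / k + (g 0 j) ^ 2) ≤ 1 := by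
    have h1 : ∀ ω, ∑ j, (inner ℝ (r j) (y ω) + g 0 j) ^ 2 ≤ 1 := by
      intro ω
      have := hg ω
      simp only [hr]
      have h2 : ‖g (y ω)‖ ^ 2 ≤ 1 := pow_le_one₀ (norm_nonneg _) this
      rw [EuclideanSpace.norm_sq_eq] at h2
      simpa using h2
    have h3 : ∫ ω, ∑ j, (inner ℝ (r j) (y ω) + g 0 j) ^ 2 ∂μ ≤ ∫ _, (1 : ℝ) ∂μ :=
      integral_mono (integrable_finsetSum _ fun j _ => hint _ _) (integrable_const _) h1
    rw [integral_finsetSum _ fun j _ => hint _ _] at h3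
    simpa [hval] using h3
  have hdet : LinearMap.det g.linear = M.det := (LinearMap.det_toMatrix bs g.linear).symm
  rw [hdet]
  refine (Matrix.det_sq_le_exp M).trans (Real.exp_le_exp.2 ?_)
  have hrn : ∀ j, ‖r j‖ ^ 2 = ∑ i, M j i ^ 2 := by
    intro j
    rw [EuclideanSpace.norm_sq_eq]
    simp [r]
  have hg0 : ‖g 0‖ ^ 2 = ∑ j, g 0 j ^ 2 := by
    rw [EuclideanSpace.norm_sq_eq]; simp
  rw [Finset.sum_add_distrib, ← Finset.sum_div, ← hg0] at hsum
  simp only [hrn] at hsum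
  rw [Fintype.card_fin]
  rcases Nat.eq_zero_or_pos k with rfl | hk
  · simp
  · have hk' : (0 : ℝ) < k := by exact_mod_cast hk
    have : (∑ j, ∑ i, M j i ^ 2) / k ≤ 1 - ‖g 0‖ ^ 2 := by linarith
    rw [div_le_iff₀ hk'] at this
    linarith

open MeasureTheory in
/-- John's criterion: if `S` lies in the image of the unit ball under the coordinate system `f`
and touches it along a centred tight frame, this image is a least-volume ellipsoid of `S`, and
all least-volume ellipsoids have the same center. -/
theorem isLeastVolumeEllipsoid_of_tightFrame {S : Set V} {k : ℕ}
    (f : EuclideanSpace ℝ (Fin k) →ᵃ[ℝ] V) (hf : IsCoordinateSystem (affineSpan ℝ S) f)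
    (hS : S ⊆ f '' Metric.closedBall 0 1)
    {Ω : Type*} [MeasurableSpace Ω] (μ : Measure Ω) [IsProbabilityMeasure μ]
    (y : Ω → EuclideanSpace ℝ (Fin k)) (hy : ∀ ω, f (y ω) ∈ S)
    (hint : ∀ (z : EuclideanSpace ℝ (Fin k)) (c : ℝ),
      Integrable (fun ω => (inner ℝ z (y ω) + c) ^ 2) μ)
    (hval : ∀ (z : EuclideanSpace ℝ (Fin k)) (c : ℝ),
      ∫ ω, (inner ℝ z (y ω) + c) ^ 2 ∂μ = ‖z‖ ^ 2 / k + c ^ 2) :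
    IsLeastVolumeEllipsoid S (f 0) (f '' Metric.closedBall 0 1) ∧
      ∀ c E, IsLeastVolumeEllipsoid S c E → c = f 0 := by
  -- In the coordinates f, a competing ellipsoid is h(ball) for an affine equivalence h. As it
  -- contains the contact points, h⁻¹ sends them into the unit ball, so the determinant bound
  -- applies to h⁻¹.
  have main : ∀ (c' : V) (E' : Set V), IsEllipsoid (affineSpan ℝ S) c' E' → S ⊆ E' →
      ∃ h : EuclideanSpace ℝ (Fin k) ≃ᵃ[ℝ] EuclideanSpace ℝ (Fin k),
        f (h 0) = c' ∧ E' = f '' (h '' Metric.closedBall 0 1) ∧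
        (LinearMap.det (h.symm : EuclideanSpace ℝ (Fin k) →ᵃ[ℝ] EuclideanSpace ℝ (Fin k)).linear) ^ 2
          ≤ Real.exp (-(k * ‖h.symm 0‖ ^ 2)) := by
    rintro c' E' ⟨k', f', hf', hc', hE'⟩ hSE
    obtain ⟨h, hh⟩ := hf.exists_affineEquiv hf'
    have hk : k' = k := by
      simpa using h.linear.finrank_eq
    subst hk
    refine ⟨h, by rw [hh, hc'], ?_, ?_⟩
    · rw [hE', Set.image_image]
      exact Set.image_congr fun x _ => (hh x).symm
    · refine det_sq_le_exp_of_tightFrame μ y hint hval _ fun ω => ?_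
      obtain ⟨x, hx, hxy⟩ : f (y ω) ∈ f' '' Metric.closedBall 0 1 := hE' ▸ hSE (hy ω)
      have : h x = y ω := hf.1 (by rw [hh, hxy])
      have h2 : h.symm (y ω) = x := by rw [← this, AffineEquiv.symm_apply_apply]
      have h3 : ‖x‖ ≤ 1 := by simpa using hx
      simpa [h2] using h3
  have hdet : ∀ h : EuclideanSpace ℝ (Fin k) ≃ᵃ[ℝ] EuclideanSpace ℝ (Fin k),
      LinearMap.det (h : EuclideanSpace ℝ (Fin k) →ᵃ[ℝ] EuclideanSpace ℝ (Fin k)).linear *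
      LinearMap.det (h.symm : EuclideanSpace ℝ (Fin k) →ᵃ[ℝ] EuclideanSpace ℝ (Fin k)).linear
        = 1 := by
    intro h
    exact LinearEquiv.det_mul_det_symm h.linear
  have hball : ∀ h : EuclideanSpace ℝ (Fin k) ≃ᵃ[ℝ] EuclideanSpace ℝ (Fin k),
      f ⁻¹' (f '' (h '' Metric.closedBall 0 1)) = h '' Metric.closedBall 0 1 :=
    fun h => Set.preimage_image_eq _ hf.1
  refine ⟨⟨⟨k, f, hf, rfl, rfl⟩, hS, ?_⟩, ?_⟩
  · intro c' E' hE' hSE l p hp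
    obtain ⟨h, -, hEh, hle⟩ := main c' E' hE' hSE
    obtain ⟨e, he⟩ := hp.exists_affineEquiv hf
    have hk : k = l := by
      simpa using e.linear.finrank_eq
    subst hk
    have hpre : ∀ s : Set (EuclideanSpace ℝ (Fin k)), p ⁻¹' (f '' s) = e '' s := by
      intro s
      have : f '' s = p '' (e '' s) := by
        rw [Set.image_image]; exact Set.image_congr fun x _ => (he x).symm
      rw [this, Set.preimage_image_eq _ hp.1]
    rw [hEh, hpre, hpre]
    have v := volume_image_affineMap
      (e : EuclideanSpace ℝ (Fin k) →ᵃ[ℝ] EuclideanSpace ℝ (Fin k))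
    have v' := volume_image_affineMap
      (h : EuclideanSpace ℝ (Fin k) →ᵃ[ℝ] EuclideanSpace ℝ (Fin k))
    simp only [AffineEquiv.coe_toAffineMap] at v v'
    rw [v, v, v']
    gcongr
    refine le_mul_of_one_le_left (zero_le) ?_
    rw [ENNReal.one_le_ofReal]
    have h1 : |LinearMap.det
        (h.symm : EuclideanSpace ℝ (Fin k) →ᵃ[ℝ] EuclideanSpace ℝ (Fin k)).linear| ≤ 1 := by
      rw [← sq_le_one_iff_abs_le_one]
      refine hle.trans (Real.exp_le_one_iff.2 ?_)
      have : 0 ≤ (k : ℝ) * ‖h.symm 0‖ ^ 2 := by positivity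
      linarith
    have h2 := congrArg abs (hdet h)
    rw [abs_mul, abs_one] at h2
    nlinarith [abs_nonneg (LinearMap.det
      (h : EuclideanSpace ℝ (Fin k) →ᵃ[ℝ] EuclideanSpace ℝ (Fin k)).linear)]
  · rintro c E ⟨hE, hSE, hmin⟩
    obtain ⟨h, hc, hEh, hle⟩ := main c E hE hSE
    have hv := hmin (f 0) _ ⟨k, f, hf, rfl, rfl⟩ hS k f hf
    have v' := volume_image_affineMap
      (h : EuclideanSpace ℝ (Fin k) →ᵃ[ℝ] EuclideanSpace ℝ (Fin k))
    simp only [AffineEquiv.coe_toAffineMap] at v'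
    rw [hEh, hball, Set.preimage_image_eq _ hf.1, v'] at hv
    have hpos : volume (Metric.closedBall (0 : EuclideanSpace ℝ (Fin k)) 1) ≠ 0 :=
      (Metric.measure_closedBall_pos _ _ one_pos).ne'
    have hfin : volume (Metric.closedBall (0 : EuclideanSpace ℝ (Fin k)) 1) ≠ ⊤ :=
      measure_closedBall_lt_top.ne
    have h1 : |LinearMap.det
        (h : EuclideanSpace ℝ (Fin k) →ᵃ[ℝ] EuclideanSpace ℝ (Fin k)).linear| ≤ 1 := by
      have : ENNReal.ofReal |LinearMap.det
        (h : EuclideanSpace ℝ (Fin k) →ᵃ[ℝ] EuclideanSpace ℝ (Fin k)).linear| ≤ 1 := by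
        refine (ENNReal.mul_le_mul_iff_left hpos hfin).1 ?_
        rwa [one_mul]
      simpa using this
    have h2 := congrArg abs (hdet h)
    rw [abs_mul, abs_one] at h2
    have h3 : 1 ≤ |LinearMap.det
        (h.symm : EuclideanSpace ℝ (Fin k) →ᵃ[ℝ] EuclideanSpace ℝ (Fin k)).linear| := by
      nlinarith [abs_nonneg (LinearMap.det
        (h.symm : EuclideanSpace ℝ (Fin k) →ᵃ[ℝ] EuclideanSpace ℝ (Fin k)).linear)]
    rw [← one_le_sq_iff_one_le_abs] at h3
    have h4 := Real.one_le_exp_iff.1 (h3.trans hle)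
    -- Minimality gives 1 ≤ exp(-k‖h⁻¹ 0‖²). For k = 0 this says nothing, but then the space is a
    -- point.
    have h5 : h.symm 0 = 0 := by
      rcases Nat.eq_zero_or_pos k with rfl | hk
      · exact Subsingleton.elim _ _
      · have hk' : (0 : ℝ) < k := by exact_mod_cast hk
        have : ‖h.symm 0‖ ^ 2 ≤ 0 := by nlinarith [sq_nonneg ‖h.symm 0‖]
        have : ‖h.symm 0‖ = 0 := by
          nlinarith [sq_nonneg ‖h.symm 0‖, pow_eq_zero_iff (two_ne_zero) |>.1
            (le_antisymm this (sq_nonneg ‖h.symm 0‖))]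
        simpa using this
    rw [← hc]
    congr 1
    rw [← h5, AffineEquiv.apply_symm_apply, h5]

end LeastVolumeEllipsoid

/-! ### Bilinear forms invariant under unitary conjugation -/

section UnitaryInvariantForms

open Matrix

variable {ι : Type*} [Fintype ι] [DecidableEq ι]

theorem Matrix.one_submatrix_mem_unitaryGroup (σ : Equiv.Perm ι) :
    (1 : Matrix ι ι ℂ).submatrix σ id ∈ unitaryGroup ι ℂ := by
  rw [mem_unitaryGroup_iff, star_eq_conjTranspose, conjTranspose_submatrix, conjTranspose_one]
  have := one_submatrix_mul (α := ℂ) σ (Equiv.refl ι) ((1 : Matrix ι ι ℂ).submatrix id σ)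
  simp only [Equiv.coe_refl, Equiv.refl_symm] at this
  rw [this]
  ext i j
  simp [one_apply]

theorem Matrix.diagonal_mem_unitaryGroup {t : ι → ℂ} (ht : ∀ i, t i * star (t i) = 1) :
    diagonal t ∈ unitaryGroup ι ℂ := by
  rw [mem_unitaryGroup_iff, star_eq_conjTranspose, diagonal_conjTranspose, diagonal_mul_diagonal]
  simp only [Pi.star_apply, ht]
  exact diagonal_one

variable (b : Matrix ι ι ℂ →ₗ[ℂ] Matrix ι ι ℂ →ₗ[ℂ] ℂ)

/-- A bilinear form on matrices that is invariant under conjugation by unitaries is a combination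
of `tr (X Y)` and `tr X * tr Y`. -/
theorem Matrix.bilinForm_eq_of_unitary_invariant
    (hb : ∀ u ∈ unitaryGroup ι ℂ, ∀ X Y, b (u * X * uᴴ) (u * Y * uᴴ) = b X Y)
    {i₀ i₁ : ι} (h01 : i₀ ≠ i₁) (X Y : Matrix ι ι ℂ) :
    b X Y = b (single i₀ i₁ 1) (single i₁ i₀ 1) * (X * Y).trace +
      b (single i₀ i₀ 1) (single i₁ i₁ 1) * (X.trace * Y.trace) := by
  -- Conjugation by the diagonal sign matrix with -1 in place k fixes the unit at (i, i) and negates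
  -- the one at (k, l).
  have hoff : ∀ i k l, k ≠ l → b (single i i 1) (single k l 1) = 0 := by
    intro i k l hkl
    have hu : diagonal (fun j => if j = k then (-1 : ℂ) else 1) ∈ unitaryGroup ι ℂ :=
      diagonal_mem_unitaryGroup fun j => by split_ifs <;> simp
    have h := hb _ hu (single i i 1) (single k l 1)
    have h1 : diagonal (fun j => if j = k then (-1 : ℂ) else 1) * single i i 1 *
        (diagonal (fun j => if j = k then (-1 : ℂ) else 1))ᴴ = single i i 1 := by
      ext a c
      rw [diagonal_conjTranspose, mul_diagonal, diagonal_mul, single_apply]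
      by_cases hac : i = a ∧ i = c
      · obtain ⟨rfl, rfl⟩ := hac
        by_cases hik : i = k <;> simp [hik]
      · simp [hac]
    have h2 : diagonal (fun j => if j = k then (-1 : ℂ) else 1) * single k l 1 *
        (diagonal (fun j => if j = k then (-1 : ℂ) else 1))ᴴ = -single k l 1 := by
      ext a c
      rw [diagonal_conjTranspose, mul_diagonal, diagonal_mul, neg_apply, single_apply]
      by_cases hac : k = a ∧ l = c
      · obtain ⟨rfl, rfl⟩ := hac
        simp [hkl.symm]
      · simp [hac]
    rw [h1, h2, map_neg] at h
    linear_combination (-1 / 2 : ℂ) * h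
  have hperm : ∀ (σ : Equiv.Perm ι) i k,
      b (single (σ i) (σ i) 1) (single (σ k) (σ k) 1) = b (single i i 1) (single k k 1) := by
    intro σ i k
    have h1 : ∀ j, (1 : Matrix ι ι ℂ).submatrix σ id * single (σ j) (σ j) 1 *
        ((1 : Matrix ι ι ℂ).submatrix σ id)ᴴ = single j j 1 := by
      intro j
      rw [conjTranspose_submatrix, conjTranspose_one]
      have e1 := one_submatrix_mul (α := ℂ) σ (Equiv.refl ι) (single (σ j) (σ j) 1)
      have e2 := mul_submatrix_one (α := ℂ) (Equiv.refl ι) σ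
        (submatrix (single (σ j) (σ j) (1 : ℂ)) σ id)
      simp only [Equiv.coe_refl, Equiv.refl_symm, Function.id_comp] at e1 e2
      rw [e1, e2]
      ext a c
      simp [single_apply]
    have h := hb _ (one_submatrix_mem_unitaryGroup σ) (single (σ i) (σ i) 1)
      (single (σ k) (σ k) 1)
    rwa [h1, h1, eq_comm] at h
  set α := b (single i₀ i₀ 1) (single i₀ i₀ 1) - b (single i₀ i₀ 1) (single i₁ i₁ 1) with hα
  set β := b (single i₀ i₀ 1) (single i₁ i₁ 1) with hβ
  have hdiag : ∀ i k, b (single i i 1) (single k k 1) = (if i = k then α else 0) + β := by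
    intro i k
    split_ifs with hik
    · subst hik
      have := hperm (Equiv.swap i i₀) i i
      simp only [Equiv.swap_apply_left] at this
      rw [← this, hα]; ring
    -- Permutations act 2-transitively, so all pairs of distinct diagonal units give the same value
    -- β.
    · obtain ⟨σ, h0, h1⟩ := (MulAction.is_two_pretransitive_iff (G := Equiv.Perm ι) (α := ι)).1
        (Equiv.Perm.isMultiplyPretransitive ι 2) h01 hik
      simp only [Equiv.Perm.smul_def] at h0 h1
      rw [← h0, ← h1, hperm, zero_add]
  have hsingle : ∀ i Y, b (single i i 1) Y = α * Y i i + β * Y.trace := by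
    intro i Y
    have hY : ∀ k l, b (single i i 1) (single k l (Y k l)) =
        if k = l then ((if i = k then α else 0) + β) * Y k k else 0 := by
      intro k l
      have : single k l (Y k l) = Y k l • single k l (1 : ℂ) := by simp
      rw [this, map_smul, smul_eq_mul]
      split_ifs with h1 h2
      · subst h1 h2
        rw [hdiag]; simp; ring
      · subst h1
        rw [hdiag]; simp [h2]; ring
      · rw [hoff _ _ _ h1, mul_zero]
    conv_lhs => rw [matrix_eq_sum_single Y]
    simp only [map_sum, hY]
    simp [add_mul, Finset.sum_add_distrib, trace, Finset.mul_sum]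
  -- Invariance allows X to be diagonalised, which reduces to `hsingle`. General X then follows by
  -- complex linearity from its real and imaginary parts.
  have hherm : ∀ X Y : Matrix ι ι ℂ, X.IsHermitian →
      b X Y = α * (X * Y).trace + β * (X.trace * Y.trace) := by
    intro X Y hX
    set U : Matrix ι ι ℂ := hX.eigenvectorUnitary.1
    have hU : U ∈ unitaryGroup ι ℂ := hX.eigenvectorUnitary.2
    have hUU : Uᴴ * U = 1 := mem_unitaryGroup_iff'.1 hU
    have hUU' : U * Uᴴ = 1 := mem_unitaryGroup_iff.1 hU
    set D : ι → ℂ := RCLike.ofReal ∘ hX.eigenvalues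
    have hsp : X = U * diagonal D * Uᴴ := hX.spectral_theorem
    have hYc : Y = U * (Uᴴ * Y * U) * Uᴴ := by
      calc Y = (U * Uᴴ) * Y * (U * Uᴴ) := by rw [hUU', one_mul, mul_one]
        _ = _ := by simp only [Matrix.mul_assoc]
    have htrX : X.trace = ∑ i, D i := by
      rw [hsp, Matrix.trace_mul_comm, ← Matrix.mul_assoc, hUU, one_mul, trace_diagonal]
    have htrY : (Uᴴ * Y * U).trace = Y.trace := by
      rw [Matrix.trace_mul_comm, ← Matrix.mul_assoc, hUU', one_mul]
    have htrXY : (X * Y).trace = ∑ i, D i * (Uᴴ * Y * U) i i := by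
      have : (X * Y).trace = (diagonal D * (Uᴴ * Y * U)).trace := by
        rw [hsp, Matrix.mul_assoc, Matrix.mul_assoc, Matrix.trace_mul_comm]
        simp only [Matrix.mul_assoc]
      rw [this]
      simp [trace, diagonal_mul]
    have hD : diagonal D = ∑ i, D i • single i i (1 : ℂ) := by
      ext a c
      simp [Matrix.sum_apply, single_apply, diagonal_apply, ite_and]
    have hbXY : b X Y = b (diagonal D) (Uᴴ * Y * U) := by
      have := hb U hU (diagonal D) (Uᴴ * Y * U)
      rwa [← hsp, ← hYc] at this
    rw [hbXY, hD]
    simp only [map_sum, map_smul, LinearMap.sum_apply, LinearMap.smul_apply, hsingle, smul_eq_mul,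
      htrY]
    rw [htrX, htrXY, Finset.mul_sum, Finset.sum_mul, Finset.mul_sum, ← Finset.sum_add_distrib]
    exact Finset.sum_congr rfl fun i _ => by ring
  have hgen : ∀ X Y : Matrix ι ι ℂ, b X Y = α * (X * Y).trace + β * (X.trace * Y.trace) := by
    intro X Y
    have hX := realPart_add_I_smul_imaginaryPart X
    have h1 := hherm _ Y (realPart X).2
    have h2 := hherm _ Y (imaginaryPart X).2
    rw [← hX]
    simp only [map_add, map_smul, LinearMap.add_apply, LinearMap.smul_apply, h1, h2, add_mul,
      smul_mul, trace_add, trace_smul, smul_eq_mul]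
    ring
  -- The coefficients are stated as values of b so that, when b depends on further matrices, the
  -- classification can be applied again to the coefficients.
  have hα' : b (single i₀ i₁ 1) (single i₁ i₀ 1) = α := by
    rw [hgen]
    simp [h01]
  rw [hα', hgen]

end UnitaryInvariantForms

/-! ### Bi-invariant probability measure on the unitary group -/

section HaarMeasure

open MeasureTheory

/-- A right translate of the normalised Haar measure is again a Haar probability measure, so
uniqueness makes it equal to the original. -/
theorem MeasureTheory.exists_isProbabilityMeasure_mul_invariant (G : Type*) [Group G]
    [TopologicalSpace G] [IsTopologicalGroup G] [CompactSpace G] [MeasurableSpace G]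
    [BorelSpace G] :
    ∃ μ : Measure G, IsProbabilityMeasure μ ∧ μ.IsMulLeftInvariant ∧ μ.IsMulRightInvariant := by
  let μ : Measure G := Measure.haarMeasure ⊤
  have hμ : IsProbabilityMeasure μ := ⟨Measure.haarMeasure_self⟩
  refine ⟨μ, hμ, inferInstance, ⟨fun g => ?_⟩⟩
  have : IsProbabilityMeasure (μ.map (· * g)) :=
    Measure.isProbabilityMeasure_map (measurable_mul_const g).aemeasurable
  exact Measure.isHaarMeasure_eq_of_isProbabilityMeasure _ _

instance Matrix.compactSpace_unitaryGroup {ι : Type*} [Fintype ι] [DecidableEq ι] :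
    CompactSpace (Matrix.unitaryGroup ι ℂ) := by
  refine isCompact_iff_compactSpace.1 (?_ : IsCompact (unitary (Matrix ι ι ℂ) : Set (Matrix ι ι ℂ)))
  have hK : IsCompact (Set.univ.pi fun _ : ι => Set.univ.pi fun _ : ι =>
      Metric.closedBall (0 : ℂ) 1) :=
    isCompact_univ_pi fun _ => isCompact_univ_pi fun _ => isCompact_closedBall _ _
  refine hK.of_isClosed_subset (isClosed_unitary (R := Matrix ι ι ℂ)) fun U hU => ?_
  simp only [Set.mem_pi, Set.mem_univ, forall_true_left, mem_closedBall_zero_iff]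
  exact fun i j => entry_norm_bound_of_unitary hU i j

end HaarMeasure

/-! ### Second moments over the local unitary orbit -/

noncomputable section LocalUnitaryOrbit

open Matrix MeasureTheory

variable {ι : Type*} [Fintype ι]

/-- The partial trace over the first factor. -/
def partialTraceFst (Z : Matrix (ι × ι) (ι × ι) ℂ) : Matrix ι ι ℂ :=
  of fun k l => ∑ i, Z (i, k) (i, l)

/-- The partial trace over the second factor. -/
def partialTraceSnd (Z : Matrix (ι × ι) (ι × ι) ℂ) : Matrix ι ι ℂ :=
  of fun i j => ∑ k, Z (i, k) (j, k)

theorem partialTraceFst_zero : partialTraceFst (0 : Matrix (ι × ι) (ι × ι) ℂ) = 0 := by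
  ext; simp [partialTraceFst]

theorem partialTraceFst_add (Z Z' : Matrix (ι × ι) (ι × ι) ℂ) :
    partialTraceFst (Z + Z') = partialTraceFst Z + partialTraceFst Z' := by
  ext; simp [partialTraceFst, Finset.sum_add_distrib]

theorem partialTraceSnd_zero : partialTraceSnd (0 : Matrix (ι × ι) (ι × ι) ℂ) = 0 := by
  ext; simp [partialTraceSnd]

theorem partialTraceSnd_add (Z Z' : Matrix (ι × ι) (ι × ι) ℂ) :
    partialTraceSnd (Z + Z') = partialTraceSnd Z + partialTraceSnd Z' := by
  ext; simp [partialTraceSnd, Finset.sum_add_distrib]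

theorem partialTraceFst_kronecker (X Y : Matrix ι ι ℂ) :
    partialTraceFst (X ⊗ₖ Y) = X.trace • Y := by
  ext; simp [partialTraceFst, trace, Finset.sum_mul]

theorem partialTraceSnd_kronecker (X Y : Matrix ι ι ℂ) :
    partialTraceSnd (X ⊗ₖ Y) = Y.trace • X := by
  ext; simp [partialTraceSnd, trace, Finset.mul_sum, mul_comm]

/-- The rank-one matrix `|ι|⁻¹ vec(w) vec(w)†`; for unitary `w` it is a maximally entangled
state. -/
def vecProjection (w : Matrix ι ι ℂ) : Matrix (ι × ι) (ι × ι) ℂ :=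
  (Fintype.card ι : ℂ)⁻¹ • vecMulVec (fun p => w p.1 p.2) (fun p => star (w p.1 p.2))

theorem vecProjection_apply (w : Matrix ι ι ℂ) (p q : ι × ι) :
    vecProjection w p q = (Fintype.card ι : ℂ)⁻¹ * (w p.1 p.2 * star (w q.1 q.2)) := rfl

/-- The identity (u ⊗ v) vec(w) = vec(u w vᵀ), which turns local conjugation into two-sided
multiplication on a single copy of the unitary group. -/
theorem kronecker_mul_vecProjection_mul (u v w : Matrix ι ι ℂ) :
    (u ⊗ₖ v) * vecProjection w * (u ⊗ₖ v)ᴴ = vecProjection (u * w * vᵀ) := by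
  have h : (u ⊗ₖ v) *ᵥ (fun p => w p.1 p.2) = fun p => (u * w * vᵀ) p.1 p.2 := by
    ext p
    simp only [mulVec, dotProduct, kroneckerMap_apply, mul_apply, transpose_apply,
      Fintype.sum_prod_type_right, Finset.sum_mul]
    refine Finset.sum_congr rfl fun j _ => Finset.sum_congr rfl fun i _ => by ring
  have h' : (fun p => star (w p.1 p.2)) ᵥ* (u ⊗ₖ v)ᴴ =
      fun p => star ((u * w * vᵀ) p.1 p.2) := by
    have := congrArg star h
    rw [star_mulVec] at this
    exact this
  rw [vecProjection, vecProjection, Matrix.mul_smul, Matrix.smul_mul, mul_vecMulVec, vecMulVec_mul, h, h']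

/-- The linear functional `Z ↦ tr (Z P_w)`. -/
def vecPairing (w : Matrix ι ι ℂ) : Matrix (ι × ι) (ι × ι) ℂ →ₗ[ℂ] ℂ :=
  traceLinearMap (ι × ι) ℂ ℂ ∘ₗ LinearMap.mulRight ℂ (vecProjection w)

theorem vecPairing_apply (w : Matrix ι ι ℂ) (Z : Matrix (ι × ι) (ι × ι) ℂ) :
    vecPairing w Z = (Z * vecProjection w).trace := rfl

theorem vecPairing_conj (u v w : Matrix ι ι ℂ) (Z : Matrix (ι × ι) (ι × ι) ℂ) :
    vecPairing w ((u ⊗ₖ v) * Z * (u ⊗ₖ v)ᴴ) = vecPairing (uᴴ * w * vᴴᵀ) Z := by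
  rw [vecPairing_apply, vecPairing_apply, ← kronecker_mul_vecProjection_mul,
    ← conjTranspose_kronecker, conjTranspose_conjTranspose, Matrix.mul_assoc, Matrix.mul_assoc,
    Matrix.trace_mul_comm]
  simp only [Matrix.mul_assoc]

theorem continuous_vecProjection : Continuous (vecProjection (ι := ι)) := by
  unfold vecProjection
  refine (Continuous.matrix_vecMulVec (R := ℂ) ?_ ?_).const_smul (Fintype.card ι : ℂ)⁻¹
  · exact continuous_pi fun p => continuous_id.matrix_elem _ _
  · exact continuous_pi fun p => (continuous_id.matrix_elem _ _).star

theorem continuous_vecPairing (Z : Matrix (ι × ι) (ι × ι) ℂ) :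
    Continuous fun w : Matrix ι ι ℂ => vecPairing w Z :=
  (Continuous.matrix_mul (A := fun _ => Z) continuous_const
    continuous_vecProjection).matrix_trace

variable [DecidableEq ι] [MeasurableSpace (unitaryGroup ι ℂ)] [BorelSpace (unitaryGroup ι ℂ)]

theorem integrable_of_continuous_unitaryGroup {E : Type*} [NormedAddCommGroup E]
    (μ : Measure (unitaryGroup ι ℂ)) [IsFiniteMeasure μ]
    {f : unitaryGroup ι ℂ → E} (hf : Continuous f) : Integrable f μ :=
  hf.integrable_of_hasCompactSupport (HasCompactSupport.of_compactSpace f)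

/-- The second moment of the functionals `tr (· P_w)` over random `w`. -/
def secondMoment (μ : Measure (unitaryGroup ι ℂ)) [IsFiniteMeasure μ] :
    Matrix (ι × ι) (ι × ι) ℂ →ₗ[ℂ] Matrix (ι × ι) (ι × ι) ℂ →ₗ[ℂ] ℂ :=
  have hint : ∀ Z Z', Integrable
      (fun w : unitaryGroup ι ℂ => vecPairing w.1 Z * vecPairing w.1 Z') μ := fun Z Z' =>
    integrable_of_continuous_unitaryGroup μ
      (((continuous_vecPairing Z).comp continuous_subtype_val).mul
        ((continuous_vecPairing Z').comp continuous_subtype_val))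
  LinearMap.mk₂ ℂ (fun Z Z' => ∫ w, vecPairing w.1 Z * vecPairing w.1 Z' ∂μ)
    (fun Z₁ Z₂ Z' => by
      simp only [map_add, add_mul]
      exact integral_add (hint _ _) (hint _ _))
    (fun c Z Z' => by
      simp only [map_smul, smul_eq_mul, mul_assoc]
      exact integral_const_mul _ _)
    (fun Z Z₁ Z₂ => by
      simp only [map_add, mul_add]
      exact integral_add (hint _ _) (hint _ _))
    (fun c Z Z' => by
      simp only [map_smul, smul_eq_mul, mul_left_comm _ c]
      exact integral_const_mul _ _)

theorem secondMoment_apply (μ : Measure (unitaryGroup ι ℂ)) [IsFiniteMeasure μ]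
    (Z Z' : Matrix (ι × ι) (ι × ι) ℂ) :
    secondMoment μ Z Z' = ∫ w, vecPairing w.1 Z * vecPairing w.1 Z' ∂μ := rfl

/-- Conjugating the arguments replaces w by a left and right translate, which the two invariances of
μ absorb. -/
theorem secondMoment_conj (μ : Measure (unitaryGroup ι ℂ)) [IsFiniteMeasure μ]
    [μ.IsMulLeftInvariant] [μ.IsMulRightInvariant] {u v : Matrix ι ι ℂ}
    (hu : u ∈ unitaryGroup ι ℂ) (hv : v ∈ unitaryGroup ι ℂ)
    (Z Z' : Matrix (ι × ι) (ι × ι) ℂ) :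
    secondMoment μ ((u ⊗ₖ v) * Z * (u ⊗ₖ v)ᴴ) ((u ⊗ₖ v) * Z' * (u ⊗ₖ v)ᴴ) =
      secondMoment μ Z Z' := by
  simp only [secondMoment_apply, vecPairing_conj]
  have hu' : uᴴ ∈ unitaryGroup ι ℂ := Unitary.star_mem hu
  have hv' : vᴴᵀ ∈ unitaryGroup ι ℂ := transpose_mem_unitaryGroup_iff.2 (Unitary.star_mem hv)
  let f : unitaryGroup ι ℂ → ℂ := fun w => vecPairing w.1 Z * vecPairing w.1 Z'
  have h1 := integral_mul_left_eq_self (μ := μ) (fun w => f (w * ⟨vᴴᵀ, hv'⟩)) ⟨uᴴ, hu'⟩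
  have h2 := integral_mul_right_eq_self (μ := μ) f ⟨vᴴᵀ, hv'⟩
  exact h1.trans h2

theorem secondMoment_kronecker_conj (μ : Measure (unitaryGroup ι ℂ)) [IsFiniteMeasure μ]
    [μ.IsMulLeftInvariant] [μ.IsMulRightInvariant] {u v : Matrix ι ι ℂ}
    (hu : u ∈ unitaryGroup ι ℂ) (hv : v ∈ unitaryGroup ι ℂ) (X Y X' Y' : Matrix ι ι ℂ) :
    secondMoment μ ((u * X * uᴴ) ⊗ₖ (v * Y * vᴴ)) ((u * X' * uᴴ) ⊗ₖ (v * Y' * vᴴ)) =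
      secondMoment μ (X ⊗ₖ Y) (X' ⊗ₖ Y') := by
  rw [← secondMoment_conj μ hu hv (X ⊗ₖ Y), conjTranspose_kronecker]
  simp only [mul_kronecker_mul]

/-- On tensors X ⊗ Y the form is invariant in each factor separately. Classifying it in the first
factor, and then classifying each coefficient in the second, leaves four products of traces, which
are the four terms here. -/
theorem exists_secondMoment_eq (μ : Measure (unitaryGroup ι ℂ)) [IsFiniteMeasure μ]
    [μ.IsMulLeftInvariant] [μ.IsMulRightInvariant] [Nontrivial ι] :
    ∃ a b c e : ℂ, ∀ Z Z' : Matrix (ι × ι) (ι × ι) ℂ, secondMoment μ Z Z' =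
      a * (Z * Z').trace + b * (partialTraceSnd Z * partialTraceSnd Z').trace +
      c * (partialTraceFst Z * partialTraceFst Z').trace + e * (Z.trace * Z'.trace) := by
  obtain ⟨i₀, i₁, h01⟩ := exists_pair_ne ι
  let K : Matrix ι ι ℂ →ₗ[ℂ] Matrix ι ι ℂ →ₗ[ℂ] Matrix (ι × ι) (ι × ι) ℂ :=
    kroneckerBilinear (R := ℂ)
  have h1 : ∀ X Y X' Y', secondMoment μ (X ⊗ₖ Y) (X' ⊗ₖ Y') =
      secondMoment μ (single i₀ i₁ 1 ⊗ₖ Y) (single i₁ i₀ 1 ⊗ₖ Y') * (X * X').trace +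
      secondMoment μ (single i₀ i₀ 1 ⊗ₖ Y) (single i₁ i₁ 1 ⊗ₖ Y') * (X.trace * X'.trace) := by
    intro X Y X' Y'
    refine bilinForm_eq_of_unitary_invariant
      ((secondMoment μ).compl₁₂ (K.flip Y) (K.flip Y')) (fun u hu X X' => ?_) h01 X X'
    have := secondMoment_kronecker_conj μ hu (one_mem _) X Y X' Y'
    rw [conjTranspose_one, one_mul, one_mul, mul_one, mul_one] at this
    exact this
  have h2 : ∀ X X' Y Y', secondMoment μ (X ⊗ₖ Y) (X' ⊗ₖ Y') =
      secondMoment μ (X ⊗ₖ single i₀ i₁ 1) (X' ⊗ₖ single i₁ i₀ 1) * (Y * Y').trace +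
      secondMoment μ (X ⊗ₖ single i₀ i₀ 1) (X' ⊗ₖ single i₁ i₁ 1) * (Y.trace * Y'.trace) := by
    intro X X' Y Y'
    refine bilinForm_eq_of_unitary_invariant
      ((secondMoment μ).compl₁₂ (K X) (K X')) (fun u hu Y Y' => ?_) h01 Y Y'
    have := secondMoment_kronecker_conj μ (one_mem _) hu X Y X' Y'
    rw [conjTranspose_one, one_mul, one_mul, mul_one, mul_one] at this
    exact this
  refine ⟨secondMoment μ (single i₀ i₁ 1 ⊗ₖ single i₀ i₁ 1) (single i₁ i₀ 1 ⊗ₖ single i₁ i₀ 1),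
    secondMoment μ (single i₀ i₁ 1 ⊗ₖ single i₀ i₀ 1) (single i₁ i₀ 1 ⊗ₖ single i₁ i₁ 1),
    secondMoment μ (single i₀ i₀ 1 ⊗ₖ single i₀ i₁ 1) (single i₁ i₁ 1 ⊗ₖ single i₁ i₀ 1),
    secondMoment μ (single i₀ i₀ 1 ⊗ₖ single i₀ i₀ 1) (single i₁ i₁ 1 ⊗ₖ single i₁ i₁ 1),
    fun Z Z' => ?_⟩
  -- Both sides are bilinear, and matrix units on the product index are tensors of matrix units.
  induction Z using Matrix.induction_on' with
  | h_zero => simp [partialTraceFst_zero, partialTraceSnd_zero]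
  | h_add p q hp hq =>
    rw [map_add, LinearMap.add_apply, hp, hq, partialTraceFst_add, partialTraceSnd_add, add_mul,
      add_mul, add_mul]
    simp only [trace_add]
    ring
  | h_std_basis p q x =>
  induction Z' using Matrix.induction_on' with
  | h_zero => simp [partialTraceFst_zero, partialTraceSnd_zero]
  | h_add p q hp hq =>
    rw [map_add, hp, hq, partialTraceFst_add, partialTraceSnd_add, mul_add, mul_add, mul_add]
    simp only [trace_add]
    ring
  | h_std_basis p' q' x' =>
    have e1 : single p q x = single p.1 q.1 x ⊗ₖ single p.2 q.2 (1 : ℂ) := by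
      rw [single_kronecker_single, mul_one]
    have e2 : single p' q' x' = single p'.1 q'.1 x' ⊗ₖ single p'.2 q'.2 (1 : ℂ) := by
      rw [single_kronecker_single, mul_one]
    rw [e1, e2]
    generalize single p.1 q.1 x = X
    generalize single p.2 q.2 (1 : ℂ) = Y
    generalize single p'.1 q'.1 x' = X'
    generalize single p'.2 q'.2 (1 : ℂ) = Y'
    rw [h1, h2 _ _ Y Y', h2 (single i₀ i₀ 1) _ Y Y', ← mul_kronecker_mul, trace_kronecker,
      trace_kronecker, trace_kronecker, partialTraceFst_kronecker, partialTraceFst_kronecker,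
      partialTraceSnd_kronecker, partialTraceSnd_kronecker, smul_mul_smul_comm,
      smul_mul_smul_comm, trace_smul, trace_smul, smul_eq_mul, smul_eq_mul]
    ring

end LocalUnitaryOrbit

/-! ### Orthogonal bases of maximally entangled states -/

section BellBasis

open Matrix

/-- Orthogonality of the characters of ℤ/n: a geometric sum whose ratio is an n-th root of unity,
equal to 1 only if j = l. -/
theorem sum_pow_mul_star_pow {n : ℕ} {ζ : ℂ} (hζ : IsPrimitiveRoot ζ n) (h1 : ζ * star ζ = 1)
    (j l : Fin n) :
    ∑ b : Fin n, ζ ^ (b.1 * j.1) * star (ζ ^ (b.1 * l.1)) = if j = l then (n : ℂ) else 0 := by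
  set x := ζ ^ j.1 * star (ζ ^ l.1) with hx
  have hl : star (ζ ^ l.1) * ζ ^ l.1 = 1 := by
    rw [star_pow, ← mul_pow, mul_comm, h1, one_pow]
  have hterm : ∀ b : Fin n, ζ ^ (b.1 * j.1) * star (ζ ^ (b.1 * l.1)) = x ^ b.1 := by
    intro b
    rw [hx, mul_pow, star_pow, star_pow, ← pow_mul, ← pow_mul, mul_comm b.1, mul_comm b.1]
  have hxn : x ^ n = 1 := by
    rw [hx, mul_pow, ← star_pow, ← pow_mul, ← pow_mul, mul_comm j.1, mul_comm l.1, pow_mul,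
      pow_mul, hζ.pow_eq_one]
    simp
  have hiff : x = 1 ↔ j = l := by
    constructor
    · intro h
      have : ζ ^ j.1 = ζ ^ l.1 := by
        calc ζ ^ j.1 = x * ζ ^ l.1 := by rw [hx, mul_assoc, hl, mul_one]
          _ = _ := by rw [h, one_mul]
      exact Fin.ext (hζ.pow_inj j.2 l.2 this)
    · rintro rfl
      rw [hx, mul_comm, hl]
  simp only [hterm]
  rw [Fin.sum_univ_eq_sum_range (fun b => x ^ b) n]
  split_ifs with hjl
  · simp [hiff.2 hjl]
  · have : x - 1 ≠ 0 := sub_ne_zero.2 fun h => hjl (hiff.1 h)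
    rw [geom_sum_eq (fun h => hjl (hiff.1 h)), hxn, sub_self, zero_div]

/-- Every maximally entangled state belongs to an orthogonal resolution of the identity into
maximally entangled states. -/
theorem exists_sum_vecProjection_eq_one {n : ℕ} [NeZero n] {u : Matrix (Fin n) (Fin n) ℂ}
    (hu : u ∈ unitaryGroup (Fin n) ℂ) :
    ∃ W : Fin n × Fin n → Matrix (Fin n) (Fin n) ℂ, (∀ s, W s ∈ unitaryGroup (Fin n) ℂ) ∧
      W 0 = u ∧ ∑ s, vecProjection (W s) = 1 := by
  have hn : n ≠ 0 := NeZero.ne n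
  obtain ⟨ζ, hζ⟩ : ∃ ζ : ℂ, IsPrimitiveRoot ζ n := ⟨_, Complex.isPrimitiveRoot_exp n hn⟩
  have h1 : ζ * star ζ = 1 := by
    have := hζ.norm'_eq_one hn
    rw [Complex.star_def, Complex.mul_conj, Complex.normSq_eq_norm_sq, this]
    simp
  -- Weyl-Heisenberg unitaries: a cyclic shift by s.1 times the s.2-th power of the clock matrix.
  let W : Fin n × Fin n → Matrix (Fin n) (Fin n) ℂ := fun s =>
    (1 : Matrix (Fin n) (Fin n) ℂ).submatrix (Equiv.subRight s.1) id *
      diagonal fun j => ζ ^ (s.2.1 * j.1)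
  have hW : ∀ s, W s ∈ unitaryGroup (Fin n) ℂ := by
    intro s
    refine mul_mem (one_submatrix_mem_unitaryGroup _) (diagonal_mem_unitaryGroup fun j => ?_)
    rw [star_pow, ← mul_pow, h1, one_pow]
  have hWe : ∀ s i j, W s i j = if s.1 = i - j then ζ ^ (s.2.1 * j.1) else 0 := by
    intro s i j
    simp only [W, mul_diagonal, submatrix_apply, one_apply, Equiv.subRight_apply, id]
    have : i - s.1 = j ↔ s.1 = i - j := by
      constructor <;> intro h
      · rw [← h]; abel
      · rw [h]; abel
    simp [this]
  have hsum : ∑ s, vecProjection (W s) = 1 := by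
    ext p q
    rw [Matrix.sum_apply]
    simp only [vecProjection_apply, hWe, Fintype.card_fin, Fintype.sum_prod_type]
    -- Summing over clock powers forces equal second indices; the later sum over shifts then forces
    -- equal first indices.
    have hinner : ∀ a : Fin n, ∑ b : Fin n, (n : ℂ)⁻¹ *
        ((if a = p.1 - p.2 then ζ ^ (b.1 * p.2.1) else 0) *
          star (if a = q.1 - q.2 then ζ ^ (b.1 * q.2.1) else 0)) =
        if a = p.1 - p.2 then (if a = q.1 - q.2 ∧ p.2 = q.2 then 1 else 0) else 0 := by
      intro a
      rw [← Finset.mul_sum]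
      by_cases ha : a = p.1 - p.2
      · by_cases hb : a = q.1 - q.2
        · simp only [if_pos ha, if_pos hb]
          rw [sum_pow_mul_star_pow hζ h1]
          have : (n : ℂ) ≠ 0 := by exact_mod_cast hn
          by_cases hc : p.2 = q.2 <;> simp [hb, hc, this]
        · simp [hb]
      · simp [ha]
    simp only [hinner]
    rw [Finset.sum_ite_eq']
    simp only [Finset.mem_univ, if_true, one_apply]
    congr 1
    rw [Prod.ext_iff, eq_iff_iff]
    constructor
    · rintro ⟨h, h'⟩
      rw [h'] at h
      exact ⟨sub_left_injective h, h'⟩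
    · rintro ⟨h, h'⟩
      rw [h, h']
      exact ⟨rfl, rfl⟩
  -- Left multiplication by u moves the basis element at 0 from the identity to u, and conjugation
  -- by u ⊗ 1 preserves the sum 1.
  refine ⟨fun s => u * W s, fun s => mul_mem hu (hW s), ?_, ?_⟩
  · have : W 0 = 1 := by
      ext i j
      rw [hWe, one_apply]
      have : (0 : Fin n) = i - j ↔ i = j := by rw [eq_comm, sub_eq_zero]
      simp [this]
    show u * W 0 = u
    rw [this, mul_one]
  · have h : ∀ s, vecProjection (u * W s) = (u ⊗ₖ 1) * vecProjection (W s) * (u ⊗ₖ 1)ᴴ := by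
      intro s
      rw [kronecker_mul_vecProjection_mul, transpose_one, mul_one]
    simp only [h]
    rw [← Finset.sum_mul, ← Finset.mul_sum, hsum, mul_one]
    exact mem_unitaryGroup_iff.1 (kronecker_mem_unitary hu (one_mem _))

end BellBasis

/-! ### Convex geometry of the hull -/

section MaxEntangledStates

open Matrix

theorem maxEntangledState_eq (n : ℕ) : maxEntangledState n = vecProjection 1 := by
  have hv : ∀ p : Fin n × Fin n, maxEntangledVector n p =
      ((1 / Real.sqrt n : ℝ) : ℂ) * (1 : Matrix (Fin n) (Fin n) ℂ) p.1 p.2 := by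
    intro p
    simp [maxEntangledVector, Pi.single_apply, one_apply]
  have hsq : ((1 / Real.sqrt n : ℝ) : ℂ) * ((1 / Real.sqrt n : ℝ) : ℂ) = (n : ℂ)⁻¹ := by
    rw [← Complex.ofReal_mul, div_mul_div_comm, one_mul, Real.mul_self_sqrt (Nat.cast_nonneg n)]
    simp
  ext p q
  rw [vecProjection_apply, maxEntangledState, vecMulVec_apply, Pi.star_apply, hv, hv, star_mul',
    Complex.star_def, Complex.conj_ofReal, mul_mul_mul_comm, hsq, Fintype.card_fin]

theorem maxEntangledStates_eq (n : ℕ) :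
    maxEntangledStates n = vecProjection '' (unitaryGroup (Fin n) ℂ : Set _) := by
  ext X
  constructor
  · rintro ⟨u, hu, v, hv, rfl⟩
    refine ⟨u * 1 * vᵀ, mul_mem (mul_mem hu (one_mem _)) (transpose_mem_unitaryGroup_iff.2 hv), ?_⟩
    rw [maxEntangledState_eq, ← conjTranspose_kronecker, kronecker_mul_vecProjection_mul]
  · rintro ⟨w, hw, rfl⟩
    refine ⟨w, hw, 1, one_mem _, ?_⟩
    rw [maxEntangledState_eq, ← conjTranspose_kronecker, kronecker_mul_vecProjection_mul,
      transpose_one, mul_one, mul_one]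

theorem vecProjection_mem_maxEntangledHull {n : ℕ} {w : Matrix (Fin n) (Fin n) ℂ}
    (hw : w ∈ unitaryGroup (Fin n) ℂ) : vecProjection w ∈ maxEntangledHull n :=
  subset_convexHull ℝ _ (by rw [maxEntangledStates_eq]; exact ⟨w, hw, rfl⟩)

variable {n : ℕ}

theorem inv_smul_one_mem_maxEntangledHull [NeZero n] :
    ((n : ℝ) ^ 2)⁻¹ • (1 : Matrix (Fin n × Fin n) (Fin n × Fin n) ℂ) ∈ maxEntangledHull n := by
  obtain ⟨W, hW, -, hsum⟩ := exists_sum_vecProjection_eq_one (n := n) (one_mem _)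
  rw [← hsum, Finset.smul_sum]
  have hn : (n : ℝ) ≠ 0 := by exact_mod_cast NeZero.ne n
  refine (convex_convexHull ℝ (maxEntangledStates n)).sum_mem (fun _ _ => by positivity) ?_
    fun s _ => vecProjection_mem_maxEntangledHull (hW s)
  simp only [Finset.sum_const, Finset.card_univ, Fintype.card_prod, Fintype.card_fin,
    nsmul_eq_mul, Nat.cast_mul]
  field_simp

/-- This is the average of the other n² - 1 states of a Bell basis through w; it supplies the lower
bound on the coefficient of symmetry. -/
theorem complement_mem_maxEntangledHull (hn : 2 ≤ n) {w : Matrix (Fin n) (Fin n) ℂ}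
    (hw : w ∈ unitaryGroup (Fin n) ℂ) :
    ((n : ℝ) ^ 2 - 1)⁻¹ • (1 - vecProjection w) ∈ maxEntangledHull n := by
  have : NeZero n := ⟨by omega⟩
  obtain ⟨W, hW, hW0, hsum⟩ := exists_sum_vecProjection_eq_one hw
  have hn1 : (1 : ℝ) < (n : ℝ) ^ 2 := by
    have : (2 : ℝ) ≤ n := by exact_mod_cast hn
    nlinarith
  have hs : 1 - vecProjection w = ∑ s ∈ Finset.univ.erase 0, vecProjection (W s) := by
    rw [← hsum, ← Finset.add_sum_erase _ _ (Finset.mem_univ 0), hW0, add_sub_cancel_left]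
  rw [hs, Finset.smul_sum]
  refine (convex_convexHull ℝ (maxEntangledStates n)).sum_mem
    (fun _ _ => inv_nonneg.2 (by linarith)) ?_
    fun s _ => vecProjection_mem_maxEntangledHull (hW s)
  rw [Finset.sum_const, Finset.card_erase_of_mem (Finset.mem_univ _), Finset.card_univ,
    Fintype.card_prod, Fintype.card_fin, nsmul_eq_mul, Nat.cast_sub (Nat.mul_self_le_mul_self
      (show 1 ≤ n by omega)), Nat.cast_mul, Nat.cast_one, ← sq]
  exact mul_inv_cancel₀ (by linarith)

/-- The pairing equals |⟨w, u⟩|²/n². It gives the half-space behind the upper bound on the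
coefficient. -/
theorem re_vecPairing_vecProjection_nonneg (u w : Matrix (Fin n) (Fin n) ℂ) :
    0 ≤ (vecPairing u (vecProjection w)).re := by
  rw [vecPairing_apply, vecProjection, vecProjection, Matrix.smul_mul, Matrix.mul_smul,
    vecMulVec_mul_vecMulVec, smul_smul, trace_smul, trace_vecMulVec, dotProduct_smul]
  have h : (fun p : Fin n × Fin n => w p.1 p.2) ⬝ᵥ (fun p => star (u p.1 p.2)) =
      star ((fun p : Fin n × Fin n => star (w p.1 p.2)) ⬝ᵥ (fun p => u p.1 p.2)) := by
    simp [dotProduct, star_sum, mul_comm]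
  rw [h, smul_eq_mul, smul_eq_mul, Complex.star_def, Complex.mul_conj, ← mul_inv, ← Nat.cast_mul,
    ← Complex.ofReal_natCast, ← Complex.ofReal_inv, ← Complex.ofReal_mul, Complex.ofReal_re]
  exact mul_nonneg (by positivity) (Complex.normSq_nonneg _)

theorem re_vecPairing_nonneg_of_mem_maxEntangledHull (u : Matrix (Fin n) (Fin n) ℂ)
    {X : Matrix (Fin n × Fin n) (Fin n × Fin n) ℂ} (hX : X ∈ maxEntangledHull n) :
    0 ≤ (vecPairing u X).re := by
  let ℓ : Matrix (Fin n × Fin n) (Fin n × Fin n) ℂ →ₗ[ℝ] ℝ :=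
    Complex.reLm ∘ₗ (vecPairing u).restrictScalars ℝ
  have hconv : Convex ℝ {X | 0 ≤ ℓ X} := convex_halfSpace_ge ℓ.isLinear 0
  refine convexHull_min ?_ hconv hX
  rw [maxEntangledStates_eq]
  rintro _ ⟨w, -, rfl⟩
  exact re_vecPairing_vecProjection_nonneg u w

theorem sum_star_mul_of_mem_unitaryGroup {w : Matrix (Fin n) (Fin n) ℂ}
    (hw : w ∈ unitaryGroup (Fin n) ℂ) (k l : Fin n) :
    ∑ i, w i k * star (w i l) = (1 : Matrix (Fin n) (Fin n) ℂ) l k := by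
  rw [← mem_unitaryGroup_iff'.1 hw, mul_apply]
  exact Finset.sum_congr rfl fun i _ => mul_comm _ _

theorem partialTraceFst_vecProjection {w : Matrix (Fin n) (Fin n) ℂ}
    (hw : w ∈ unitaryGroup (Fin n) ℂ) :
    partialTraceFst (vecProjection w) = (n : ℂ)⁻¹ • 1 := by
  ext k l
  simp only [partialTraceFst, of_apply, vecProjection_apply, ← Finset.mul_sum,
    sum_star_mul_of_mem_unitaryGroup hw, Fintype.card_fin, Matrix.smul_apply, smul_eq_mul, one_apply,
    eq_comm]

theorem partialTraceSnd_vecProjection {w : Matrix (Fin n) (Fin n) ℂ}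
    (hw : w ∈ unitaryGroup (Fin n) ℂ) :
    partialTraceSnd (vecProjection w) = (n : ℂ)⁻¹ • 1 := by
  have h := sum_star_mul_of_mem_unitaryGroup (transpose_mem_unitaryGroup_iff.2 hw)
  simp only [transpose_apply] at h
  ext k l
  simp only [partialTraceSnd, of_apply, vecProjection_apply, ← Finset.mul_sum,
    h, Fintype.card_fin, Matrix.smul_apply, smul_eq_mul, one_apply, eq_comm]

theorem isHermitian_vecProjection (w : Matrix (Fin n) (Fin n) ℂ) :
    (vecProjection w).IsHermitian := by
  ext p q
  simp [vecProjection_apply, conjTranspose_apply, mul_comm]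

theorem trace_vecProjection [NeZero n] {w : Matrix (Fin n) (Fin n) ℂ}
    (hw : w ∈ unitaryGroup (Fin n) ℂ) : (vecProjection w).trace = 1 := by
  have h : (vecProjection w).trace = (partialTraceSnd (vecProjection w)).trace := by
    simp [trace, partialTraceSnd, Fintype.sum_prod_type]
  have hn : (n : ℂ) ≠ 0 := by exact_mod_cast NeZero.ne n
  rw [h, partialTraceSnd_vecProjection hw, trace_smul, trace_one, Fintype.card_fin, smul_eq_mul,
    inv_mul_cancel₀ hn]

theorem vecPairing_self [NeZero n] {w : Matrix (Fin n) (Fin n) ℂ}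
    (hw : w ∈ unitaryGroup (Fin n) ℂ) : vecPairing w (vecProjection w) = 1 := by
  have hn : (n : ℂ) ≠ 0 := by exact_mod_cast NeZero.ne n
  have ht := trace_vecProjection hw
  rw [vecProjection, trace_smul, trace_vecMulVec, smul_eq_mul] at ht
  rw [vecPairing_apply, vecProjection, Matrix.smul_mul, Matrix.mul_smul,
    vecMulVec_mul_vecMulVec, smul_smul, trace_smul, trace_vecMulVec, dotProduct_smul,
    smul_eq_mul, smul_eq_mul, mul_mul_mul_comm, ht, mul_one, dotProduct_comm, ht]

/-- All maximally entangled states are Hermitian with both partial traces equal to 1/n, so their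
differences have zero partial traces. This inclusion suffices to kill three of the four
second-moment terms; the span need not be determined exactly. -/
theorem mem_vectorSpan_maxEntangledHull {Z : Matrix (Fin n × Fin n) (Fin n × Fin n) ℂ}
    (hZ : Z ∈ vectorSpan ℝ (maxEntangledHull n)) :
    Z.IsHermitian ∧ partialTraceFst Z = 0 ∧ partialTraceSnd Z = 0 := by
  let D : Submodule ℝ (Matrix (Fin n × Fin n) (Fin n × Fin n) ℂ) :=
    { carrier := {Z | Z.IsHermitian ∧ partialTraceFst Z = 0 ∧ partialTraceSnd Z = 0}
      add_mem' := fun hX hY => ⟨hX.1.add hY.1,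
        by rw [partialTraceFst_add, hX.2.1, hY.2.1, add_zero],
        by rw [partialTraceSnd_add, hX.2.2, hY.2.2, add_zero]⟩
      zero_mem' := ⟨isHermitian_zero, partialTraceFst_zero, partialTraceSnd_zero⟩
      smul_mem' := fun c X hX => by
        refine ⟨?_, ?_, ?_⟩
        · rw [IsHermitian, conjTranspose_smul, hX.1, star_trivial]
        · ext k l
          have := congrFun (congrFun hX.2.1 k) l
          simp only [partialTraceFst, of_apply, Matrix.zero_apply] at this
          simp [partialTraceFst, ← Finset.mul_sum, this]
        · ext k l
          have := congrFun (congrFun hX.2.2 k) l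
          simp only [partialTraceSnd, of_apply, Matrix.zero_apply] at this
          simp [partialTraceSnd, ← Finset.mul_sum, this] }
  have hle : vectorSpan ℝ (maxEntangledHull n) ≤ D := by
    rw [← direction_affineSpan, maxEntangledHull, affineSpan_convexHull, direction_affineSpan,
      maxEntangledStates_eq]
    refine Submodule.span_le.2 ?_
    rintro _ ⟨_, ⟨u, hu, rfl⟩, _, ⟨w, hw, rfl⟩, rfl⟩
    have hF : ∀ X Y : Matrix (Fin n × Fin n) (Fin n × Fin n) ℂ,
        partialTraceFst X = partialTraceFst Y → partialTraceFst (X - Y) = 0 := by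
      intro X Y h
      have := partialTraceFst_add (X - Y) Y
      rwa [sub_add_cancel, h, right_eq_add] at this
    have hS : ∀ X Y : Matrix (Fin n × Fin n) (Fin n × Fin n) ℂ,
        partialTraceSnd X = partialTraceSnd Y → partialTraceSnd (X - Y) = 0 := by
      intro X Y h
      have := partialTraceSnd_add (X - Y) Y
      rwa [sub_add_cancel, h, right_eq_add] at this
    exact ⟨(isHermitian_vecProjection u).sub (isHermitian_vecProjection w),
      hF _ _ (by rw [partialTraceFst_vecProjection hu, partialTraceFst_vecProjection hw]),
      hS _ _ (by rw [partialTraceSnd_vecProjection hu, partialTraceSnd_vecProjection hw])⟩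
  exact hle hZ

end MaxEntangledStates

/-! ### Isotropy of the orbit and the least-volume ellipsoid -/

section TightFrame

open Matrix MeasureTheory

/-- A real space of complex matrices has linear coordinates that are isometric for the
Hilbert-Schmidt inner product. -/
theorem Matrix.exists_isometric_coordinates {p : Type*} [Fintype p]
    (D : Submodule ℝ (Matrix p p ℂ)) :
    ∃ (k : ℕ) (L : EuclideanSpace ℝ (Fin k) →ₗ[ℝ] Matrix p p ℂ), LinearMap.range L = D ∧
      ∀ x y, ((L x)ᴴ * L y).trace.re = inner ℝ x y := by
  let Ψ : EuclideanSpace ℂ (p × p) →ₗ[ℝ] Matrix p p ℂ :=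
    { toFun := fun x => of fun i j => x (i, j)
      map_add' := fun x y => rfl
      map_smul' := fun c x => rfl }
  have hΨ : Function.Surjective Ψ := fun X => ⟨WithLp.toLp 2 fun q => X q.1 q.2, rfl⟩
  have hinner : ∀ x y, ((Ψ x)ᴴ * Ψ y).trace.re = inner ℝ x y := by
    intro x y
    simp only [trace, diag_apply, mul_apply, conjTranspose_apply, Complex.re_sum,
      PiLp.inner_apply, Complex.inner, Fintype.sum_prod_type_right]
    exact Finset.sum_congr rfl fun j _ => Finset.sum_congr rfl fun i _ =>
      congrArg Complex.re (mul_comm _ _)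
  let b := stdOrthonormalBasis ℝ (D.comap Ψ)
  refine ⟨_, Ψ ∘ₗ (D.comap Ψ).subtype ∘ₗ b.repr.symm.toLinearEquiv.toLinearMap, ?_, fun x y => ?_⟩
  · rw [LinearMap.range_comp, LinearMap.range_comp, LinearEquiv.range, Submodule.map_top,
      Submodule.range_subtype, Submodule.map_comap_eq_of_surjective hΨ]
  · refine (hinner _ _).trans ?_
    exact b.repr.symm.inner_map_map x y

variable {n : ℕ}

theorem vecPairing_one [NeZero n] {w : Matrix (Fin n) (Fin n) ℂ}
    (hw : w ∈ unitaryGroup (Fin n) ℂ) : vecPairing w 1 = 1 := by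
  rw [vecPairing_apply, one_mul, trace_vecProjection hw]

theorem ofReal_re_vecPairing_of_isHermitian (w : Matrix (Fin n) (Fin n) ℂ)
    {Z : Matrix (Fin n × Fin n) (Fin n × Fin n) ℂ} (hZ : Z.IsHermitian) :
    ((vecPairing w Z).re : ℂ) = vecPairing w Z := by
  rw [← Complex.conj_eq_iff_re, vecPairing_apply, ← Complex.star_def, ← trace_conjTranspose,
    conjTranspose_mul, hZ.eq, (isHermitian_vecProjection w).eq, Matrix.trace_mul_comm]

/-- Moments of the maximally entangled states: on the direction of the hull, the first moments
vanish and the second moments are proportional to the Hilbert-Schmidt form. -/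
theorem exists_moments [MeasurableSpace (unitaryGroup (Fin n) ℂ)]
    [BorelSpace (unitaryGroup (Fin n) ℂ)] (hn : 2 ≤ n) (μ : Measure (unitaryGroup (Fin n) ℂ))
    [IsFiniteMeasure μ] [μ.IsMulLeftInvariant] [μ.IsMulRightInvariant] :
    ∃ a : ℝ, ∀ Z ∈ vectorSpan ℝ (maxEntangledHull n),
      ∫ w : unitaryGroup (Fin n) ℂ, (vecPairing w.1 Z).re ∂μ = 0 ∧
      ∫ w : unitaryGroup (Fin n) ℂ, (vecPairing w.1 Z).re ^ 2 ∂μ = a * (Zᴴ * Z).trace.re := by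
  have : NeZero n := ⟨by omega⟩
  have : Nontrivial (Fin n) := Fin.nontrivial_iff_two_le.2 hn
  obtain ⟨a, b, c, e, h⟩ := exists_secondMoment_eq μ
  refine ⟨a.re, fun Z hZ => ?_⟩
  obtain ⟨hH, hF, hS⟩ := mem_vectorSpan_maxEntangledHull hZ
  have htr : Z.trace = 0 := by
    have h : Z.trace = (partialTraceSnd Z).trace := by
      simp [trace, partialTraceSnd, Fintype.sum_prod_type]
    rw [h, hS, trace_zero]
  constructor
  -- Every state pairs to 1 with the identity, so the second moment of Z against 1 is the first
  -- moment of Z.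
  · have h1 := h Z 1
    rw [hF, hS, mul_one, htr, secondMoment_apply] at h1
    simp only [vecPairing_one (Subtype.prop _), zero_mul, trace_zero, mul_zero, add_zero,
      mul_one] at h1
    rw [← Complex.ofReal_inj, ← integral_complex_ofReal]
    simpa only [ofReal_re_vecPairing_of_isHermitian _ hH, Complex.ofReal_zero] using h1
  · have h1 := h Z Z
    rw [hF, hS, htr, secondMoment_apply] at h1
    simp only [trace_zero, mul_zero, add_zero] at h1
    have him : (Zᴴ * Z).trace.im = 0 := by
      have : star (Zᴴ * Z).trace = (Zᴴ * Z).trace := by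
        rw [← trace_conjTranspose, conjTranspose_mul, conjTranspose_conjTranspose]
      exact Complex.conj_eq_iff_im.1 this
    have h2 : ∫ w : unitaryGroup (Fin n) ℂ, (((vecPairing w.1 Z).re ^ 2 : ℝ) : ℂ) ∂μ =
        a * (Zᴴ * Z).trace := by
      rw [hH.eq, ← h1]
      refine integral_congr_ae (Filter.Eventually.of_forall fun w => ?_)
      simp only [sq, Complex.ofReal_mul, ofReal_re_vecPairing_of_isHermitian _ hH]
    rw [integral_complex_ofReal] at h2
    have h3 := congrArg Complex.re h2
    rw [Complex.ofReal_re, Complex.mul_re, him, mul_zero, sub_zero] at h3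
    exact h3

/-- The ball around `1 / n²` through the maximally entangled states is a least-volume ellipsoid
of their hull, and every least-volume ellipsoid has this center. -/
theorem exists_isLeastVolumeEllipsoid_maxEntangledHull (hn : 2 ≤ n) :
    (∃ E, IsLeastVolumeEllipsoid (maxEntangledHull n) (((n : ℝ) ^ 2)⁻¹ • 1) E) ∧
      ∀ c E, IsLeastVolumeEllipsoid (maxEntangledHull n) c E → c = ((n : ℝ) ^ 2)⁻¹ • 1 := by
  have hn0 : NeZero n := ⟨by omega⟩
  have hn1 : (1 : ℝ) < (n : ℝ) ^ 2 := by
    have : (2 : ℝ) ≤ n := by exact_mod_cast hn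
    nlinarith
  let _ : MeasurableSpace (unitaryGroup (Fin n) ℂ) := borel _
  have : BorelSpace (unitaryGroup (Fin n) ℂ) := ⟨rfl⟩
  obtain ⟨μ, hμ, hμl, hμr⟩ :=
    exists_isProbabilityMeasure_mul_invariant (unitaryGroup (Fin n) ℂ)
  obtain ⟨a, ha⟩ := exists_moments hn μ
  obtain ⟨k, L, hL, hLi⟩ := exists_isometric_coordinates (vectorSpan ℝ (maxEntangledHull n))
  have hLmem : ∀ z, L z ∈ vectorSpan ℝ (maxEntangledHull n) := fun z => hL ▸ ⟨z, rfl⟩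
  set c : Matrix (Fin n × Fin n) (Fin n × Fin n) ℂ := ((n : ℝ) ^ 2)⁻¹ • 1 with hc
  have hcmem : c ∈ maxEntangledHull n := inv_smul_one_mem_maxEntangledHull
  -- The Hilbert-Schmidt distance from c to each maximally entangled state, since tr P² = tr P = 1
  -- and c = 1/n².
  set r : ℝ := Real.sqrt (1 - ((n : ℝ) ^ 2)⁻¹) with hr
  have hr0 : 0 < 1 - ((n : ℝ) ^ 2)⁻¹ := by
    have := inv_lt_one_of_one_lt₀ hn1
    linarith
  have hrpos : 0 < r := Real.sqrt_pos.2 hr0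
  have hrsq : r ^ 2 = 1 - ((n : ℝ) ^ 2)⁻¹ := Real.sq_sqrt hr0.le
  have hLinj : Function.Injective L := by
    rw [← LinearMap.ker_eq_bot, LinearMap.ker_eq_bot']
    intro x hx
    have := hLi x x
    rw [hx, mul_zero, trace_zero, Complex.zero_re, real_inner_self_eq_norm_sq] at this
    simpa using this.symm
  have hx : ∀ w : unitaryGroup (Fin n) ℂ, ∃ x, L x = vecProjection w.1 - c := by
    intro w
    have : vecProjection w.1 - c ∈ LinearMap.range L := by
      rw [hL]
      exact vsub_mem_vectorSpan ℝ (vecProjection_mem_maxEntangledHull w.2) hcmem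
    exact this
  choose x hx using hx
  let y : unitaryGroup (Fin n) ℂ → EuclideanSpace ℝ (Fin k) := fun w => r⁻¹ • x w
  have hLz : ∀ z, (L z).IsHermitian ∧ (L z).trace = 0 := by
    intro z
    obtain ⟨h1, -, h2⟩ := mem_vectorSpan_maxEntangledHull (hLmem z)
    refine ⟨h1, ?_⟩
    have h : (L z).trace = (partialTraceSnd (L z)).trace := by
      simp [trace, partialTraceSnd, Fintype.sum_prod_type]
    rw [h, h2, trace_zero]
  have hzx : ∀ z w, inner ℝ z (x w) = (vecPairing w.1 (L z)).re := by
    intro z w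
    rw [← hLi, hx, (hLz z).1.eq, mul_sub, trace_sub, hc, mul_smul_comm, mul_one, trace_smul,
      (hLz z).2, smul_zero, sub_zero, vecPairing_apply]
  have hzy : ∀ z w, inner ℝ z (y w) = r⁻¹ * (vecPairing w.1 (L z)).re := by
    intro z w
    rw [← hzx, real_inner_smul_right]
  have hxn : ∀ w, ‖x w‖ ^ 2 = r ^ 2 := by
    intro w
    rw [← real_inner_self_eq_norm_sq, hzx, hx, map_sub, vecPairing_self w.2, hc,
      LinearMap.map_smul_of_tower, vecPairing_one w.2, hrsq, Complex.sub_re, Complex.smul_re, Complex.one_re, smul_eq_mul,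
      mul_one]
  have hyn : ∀ w, ‖y w‖ = 1 := by
    intro w
    have : ‖x w‖ = r := (sq_eq_sq₀ (norm_nonneg _) hrpos.le).1 (hxn w)
    rw [norm_smul, this, Real.norm_of_nonneg (inv_nonneg.2 hrpos.le), inv_mul_cancel₀ hrpos.ne']
  have hcont : ∀ z, Continuous fun w : unitaryGroup (Fin n) ℂ => inner ℝ z (y w) := by
    intro z
    simp only [hzy]
    exact continuous_const.mul
      (Complex.continuous_re.comp ((continuous_vecPairing _).comp continuous_subtype_val))
  have hint1 : ∀ z, Integrable (fun w => inner ℝ z (y w)) μ := fun z =>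
    integrable_of_continuous_unitaryGroup μ (hcont z)
  have hint2 : ∀ z, Integrable (fun w => inner ℝ z (y w) ^ 2) μ := fun z =>
    integrable_of_continuous_unitaryGroup μ ((hcont z).pow 2)
  have hm1 : ∀ z, ∫ w, inner ℝ z (y w) ∂μ = 0 := by
    intro z
    simp only [hzy]
    rw [integral_const_mul, (ha _ (hLmem z)).1, mul_zero]
  have hm2' : ∀ z, ∫ w, inner ℝ z (y w) ^ 2 ∂μ = r⁻¹ ^ 2 * a * ‖z‖ ^ 2 := by
    intro z
    simp only [hzy, mul_pow]
    rw [integral_const_mul, (ha _ (hLmem z)).2, hLi, real_inner_self_eq_norm_sq]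
    ring
  -- Neither a nor the dimension k has to be computed: summing second moments over an orthonormal
  -- basis gives the mean of ‖y‖² = 1, which fixes the constant as 1/k and shows k ≠ 0.
  have hk : (k : ℝ) * (r⁻¹ ^ 2 * a) = 1 := by
    have hs : ∀ w, ∑ i, inner ℝ (EuclideanSpace.basisFun (Fin k) ℝ i) (y w) ^ 2 = 1 := by
      intro w
      have := (EuclideanSpace.basisFun (Fin k) ℝ).sum_sq_norm_inner_right (y w)
      simpa [hyn w] using this
    have h1 : ∫ w, ∑ i, inner ℝ (EuclideanSpace.basisFun (Fin k) ℝ i) (y w) ^ 2 ∂μ = 1 := by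
      simp only [hs, integral_const, probReal_univ, one_smul]
    rw [integral_finsetSum _ fun i _ => hint2 _] at h1
    simpa [hm2'] using h1
  have hk0 : (k : ℝ) ≠ 0 := left_ne_zero_of_mul_eq_one hk
  have hm2 : ∀ z, ∫ w, inner ℝ z (y w) ^ 2 ∂μ = ‖z‖ ^ 2 / k := by
    intro z
    rw [hm2', eq_div_iff hk0]
    linear_combination ‖z‖ ^ 2 * hk
  have hexp : ∀ (z : EuclideanSpace ℝ (Fin k)) (s : ℝ) w, (inner ℝ z (y w) + s) ^ 2 =
      inner ℝ z (y w) ^ 2 + (2 * s * inner ℝ z (y w) + s ^ 2) := fun z s w => by ring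
  let f : EuclideanSpace ℝ (Fin k) →ᵃ[ℝ] Matrix (Fin n × Fin n) (Fin n × Fin n) ℂ :=
    (r • L).toAffineMap + AffineMap.const ℝ _ c
  have hf_apply : ∀ z, f z = r • L z + c := fun z => rfl
  have hfy : ∀ w, f (y w) = vecProjection w.1 := by
    intro w
    rw [hf_apply, map_smul, smul_smul, mul_inv_cancel₀ hrpos.ne', one_smul, hx, sub_add_cancel]
  have hf0 : f 0 = c := by rw [hf_apply, map_zero, smul_zero, zero_add]
  have hf : IsCoordinateSystem (affineSpan ℝ (maxEntangledHull n)) f := by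
    constructor
    · intro z z' h
      rw [hf_apply, hf_apply, add_left_inj] at h
      exact hLinj (smul_right_injective _ hrpos.ne' h)
    · ext X
      have hca := mem_affineSpan ℝ hcmem
      rw [SetLike.mem_coe, ← AffineSubspace.vsub_right_mem_direction_iff_mem hca,
        direction_affineSpan, ← hL, vsub_eq_sub]
      constructor
      · rintro ⟨z, rfl⟩
        exact ⟨r • z, by rw [map_smul, hf_apply, add_sub_cancel_right]⟩
      · rintro ⟨z, hz⟩
        refine ⟨r⁻¹ • z, ?_⟩
        rw [hf_apply, map_smul, smul_smul, mul_inv_cancel₀ hrpos.ne', one_smul, hz,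
          sub_add_cancel]
  have hS : maxEntangledHull n ⊆ f '' Metric.closedBall 0 1 := by
    refine convexHull_min ?_ ((convex_closedBall 0 1).affine_image f)
    rw [maxEntangledStates_eq]
    rintro _ ⟨w, hw, rfl⟩
    exact ⟨y ⟨w, hw⟩, by simp [hyn], hfy ⟨w, hw⟩⟩
  have main := isLeastVolumeEllipsoid_of_tightFrame f hf hS μ y
    (fun w => hfy w ▸ vecProjection_mem_maxEntangledHull w.2)
    (fun z s => by
      simp only [hexp]
      exact (hint2 z).add (((hint1 z).const_mul _).add (integrable_const _)))
    (fun z s => by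
      have hlin : Integrable (fun w => 2 * s * inner ℝ z (y w) + s ^ 2) μ :=
        ((hint1 z).const_mul _).add (integrable_const _)
      simp only [hexp]
      rw [integral_add (hint2 z) hlin, integral_add ((hint1 z).const_mul _) (integrable_const _), integral_const_mul, hm1, hm2]
      simp)
  rw [hf0] at main
  exact ⟨⟨_, main.1⟩, main.2⟩

end TightFrame

/-! ### The coefficient of symmetry -/

open Matrix in
theorem mainTheorem11 (n d : ℕ) (hn : 2 ≤ n) (hd : d = n ^ 2) :
    IsCoefficientOfSymmetry (maxEntangledHull n) (1 / ((d : ℝ) - 1)) := by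
  have hn0 : NeZero n := ⟨by omega⟩
  obtain ⟨⟨E₀, hE₀⟩, huniq⟩ := exists_isLeastVolumeEllipsoid_maxEntangledHull hn
  have hdn : (d : ℝ) = (n : ℝ) ^ 2 := by rw [hd]; push_cast; rfl
  have hd4 : (4 : ℝ) ≤ d := by
    have : (2 : ℝ) ≤ n := by exact_mod_cast hn
    rw [hdn]; nlinarith
  have hd1 : (0 : ℝ) < d - 1 := by linarith
  have hd1' : (d : ℝ) - 1 ≠ 0 := hd1.ne'
  have hd0 : (d : ℝ) ≠ 0 := by linarith
  rw [← hdn] at hE₀ huniq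
  refine ⟨⟨_, _, hE₀⟩, fun c E hE => ?_⟩
  rw [huniq c E hE]
  have hmem : ∀ (a : ℝ) (X : Matrix (Fin n × Fin n) (Fin n × Fin n) ℂ),
      -(a • (X - (d : ℝ)⁻¹ • 1)) ∈ centeredAt (maxEntangledHull n) ((d : ℝ)⁻¹ • 1) ↔
        ((d : ℝ)⁻¹ • 1 - a • (X - (d : ℝ)⁻¹ • 1)) ∈ maxEntangledHull n := by
    intro a X
    constructor
    · rintro ⟨Y, hY, h⟩
      have : (d : ℝ)⁻¹ • 1 - a • (X - (d : ℝ)⁻¹ • 1) = Y := by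
        rw [sub_eq_add_neg, ← h, add_sub_cancel]
      rwa [this]
    · intro h
      exact ⟨_, h, by simp only [sub_sub_cancel_left]⟩
  refine ⟨⟨by positivity, ?_, ?_⟩, ?_⟩
  · rw [div_le_one hd1]; linarith
  · rintro _ ⟨X, hX, rfl⟩
    rw [hmem]
    -- Reflection through the center with ratio 1/(d-1) is affine, so it suffices to check the
    -- generating states, where it gives the normalised complement.
    let g : Matrix (Fin n × Fin n) (Fin n × Fin n) ℂ →ᵃ[ℝ]
        Matrix (Fin n × Fin n) (Fin n × Fin n) ℂ :=
      AffineMap.const ℝ _ ((d : ℝ)⁻¹ • 1) -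
        (1 / ((d : ℝ) - 1)) • (AffineMap.id ℝ _ - AffineMap.const ℝ _ ((d : ℝ)⁻¹ • 1))
    have hconv : Convex ℝ (g ⁻¹' maxEntangledHull n) :=
      (convex_convexHull ℝ (maxEntangledStates n)).affine_preimage g
    refine convexHull_min ?_ hconv hX
    rw [maxEntangledStates_eq]
    rintro _ ⟨w, hw, rfl⟩
    have h := complement_mem_maxEntangledHull hn hw
    rw [← hdn] at h
    have hg : g (vecProjection w) = ((d : ℝ) - 1)⁻¹ • (1 - vecProjection w) := by
      have : g (vecProjection w) = (d : ℝ)⁻¹ • (1 : Matrix (Fin n × Fin n) (Fin n × Fin n) ℂ) -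
        (1 / ((d : ℝ) - 1)) • (vecProjection w - (d : ℝ)⁻¹ • 1) := rfl
      rw [this]
      match_scalars <;> field_simp
      ring
    rw [Set.mem_preimage, hg]
    exact h
  · rintro a ⟨-, -, ha⟩
    -- Test the reflection on the single state P = `vecProjection 1` and pair the result with P:
    -- nonnegativity reads 1/d - a(1 - 1/d) ≥ 0, that is a ≤ 1/(d-1).
    have h := ha (vecProjection 1 - (d : ℝ)⁻¹ • 1)
      ⟨_, vecProjection_mem_maxEntangledHull (one_mem _), rfl⟩
    rw [hmem] at h
    have h1 := re_vecPairing_nonneg_of_mem_maxEntangledHull 1 h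
    have h2 : vecPairing 1 ((d : ℝ)⁻¹ • (1 : Matrix (Fin n × Fin n) (Fin n × Fin n) ℂ) -
        a • (vecProjection 1 - (d : ℝ)⁻¹ • 1)) = (((d : ℝ)⁻¹ - a * (1 - (d : ℝ)⁻¹) : ℝ) : ℂ) := by
      rw [map_sub, LinearMap.map_smul_of_tower, LinearMap.map_smul_of_tower, map_sub,
        LinearMap.map_smul_of_tower, vecPairing_one (one_mem _), vecPairing_self (one_mem _)]
      simp
    rw [h2, Complex.ofReal_re] at h1
    rw [le_div_iff₀ hd1]
    have h3 : (d : ℝ) * ((d : ℝ)⁻¹ - a * (1 - (d : ℝ)⁻¹)) = 1 - a * (d - 1) := by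
      field_simp
    have h4 := mul_nonneg (by linarith : (0 : ℝ) ≤ d) h1
    rw [h3] at h4
    linarith
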